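/- Let $R$ be a simple unital (not necessarily commutative) ring whose centre has at least four elements and which is generated as a ring by its invertible elements. Write $\mathrm{GL}(1,R)$ for the group of (two-sided) invertible elements of $R$. Let $\mathrm{E}(2,R)$ be the subgroup of $\mathrm{GL}(2,R)$ generated by the matrices $t_a=\begin{pmatrix}1&a\\0&1\end{pmatrix}$ ($a\in R$), $\begin{pmatrix}r&0\\0&s\end{pmatrix}$ ($r,s\in \mathrm{GL}(1,R)$) and $j=\begin{pmatrix}0&1\\1&0\end{pmatrix}$; let $\mathrm{PE}(2,R)$ be the quotient of $\mathrm{E}(2,R)$ by the scalar matrices $\begin{pmatrix}\lambda&0\\0&\lambda\end{pmatrix}$ with $\lambda$ a central invertible element of $R$; and let $\mathrm{PE}_2(2,R)$ be the subgroup of $\mathrm{PE}(2,R)$ generated by all products $e_ae_b$ ($a,b\in R$), where $e_a$ is the class of $jt_a$. Suppose that at least one of the following holds: (i) $R$ has $1$ in the stable range, that is, whenever $a,b\in R$ satisfy $Ra+Rb=R$, there is $c\in R$ such that $a+cb$ is invertible; (ii) for all $d_1,d_2,d_3\in R$, $\bigcap_{i=1}^{3}\bigl(\mathrm{GL}(1,R)-d_i\bigr)\neq\emptyset$,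 where $\mathrm{GL}(1,R)-d=\{u-d : u\in \mathrm{GL}(1,R)\}$. Then $\mathrm{PE}_2(2,R)$ is contained in every nontrivial normal subgroup of $\mathrm{PE}(2,R)$. If, in addition, the additive group of $R$ is generated by the union of the commutator subgroup $\mathrm{GL}(1,R)'$ and the set of central invertible elements, then $\mathrm{PE}_2(2,R)$ is a simple group. -/

import Mathlib

namespace ProjElem

variable (R : Type*) [Ring R]

/-- `GL(2,R)` over a possibly noncommutative ring: the two-sided invertible `2 × 2` matrices. -/
abbrev GLTwo : Type _ := (Matrix (Fin 2) (Fin 2) R)ˣ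

variable {R}

/-- The upper unitriangular matrix `t_a`. -/
def tMat (a : R) : GLTwo R where
  val := !![1, a; 0, 1]
  inv := !![1, -a; 0, 1]
  val_inv := by simp [Matrix.one_fin_two]
  inv_val := by simp [Matrix.one_fin_two]

/-- The diagonal matrix `m_{r,s}`. -/
def mMat (r s : Rˣ) : GLTwo R where
  val := !![(r : R), 0; 0, (s : R)]
  inv := !![((r⁻¹ : Rˣ) : R), 0; 0, ((s⁻¹ : Rˣ) : R)]
  val_inv := by simp [Matrix.one_fin_two]
  inv_val := by simp [Matrix.one_fin_two]

variable (R)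

/-- The transposition matrix `j`. -/
def jMat : GLTwo R where
  val := !![0, 1; 1, 0]
  inv := !![0, 1; 1, 0]
  val_inv := by simp [Matrix.one_fin_two]
  inv_val := by simp [Matrix.one_fin_two]

/-- `E(2,R)`: the subgroup of `GL(2,R)` generated by all `t_a`, all `m_{r,s}`, and `j`. -/
def E : Subgroup (GLTwo R) :=
  Subgroup.closure
    (Set.range (fun a : R => tMat a) ∪ Set.range (fun p : Rˣ × Rˣ => mMat p.1 p.2) ∪ {jMat R})

/-- The scalar matrices `diag(z, z)`, `z` a central invertible element of `R`, as a subgroup of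
`E(2,R)`. -/
def scalars : Subgroup (E R) where
  carrier := {g | ∃ z : Rˣ, (z : R) ∈ Subring.center R ∧ (g : GLTwo R) = mMat z z}
  one_mem' := ⟨1, by simp, by
    apply Units.ext
    simp [mMat, Matrix.one_fin_two]⟩
  mul_mem' := by
    rintro g h ⟨z, hz, hg⟩ ⟨w, hw, hh⟩
    refine ⟨z * w, by simpa using mul_mem hz hw, ?_⟩
    apply Units.ext
    simp [hg, hh, mMat]
  inv_mem' := by
    rintro g ⟨z, hz, hg⟩
    refine ⟨z⁻¹, ?_, ?_⟩
    · exact Set.units_inv_mem_center hz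
    · rw [Subgroup.coe_inv, hg]
      apply Units.ext
      rfl

instance scalars_normal : (scalars R).Normal where
  conj_mem := by
    rintro n ⟨z, hz, hn⟩ g
    refine ⟨z, hz, ?_⟩
    have hc : (n : GLTwo R) * (g : GLTwo R) = (g : GLTwo R) * (n : GLTwo R) := by
      rw [hn]
      apply Units.ext
      have h := fun x : R => (Subring.mem_center_iff.mp hz x).symm
      rw [Units.val_mul, Units.val_mul, Matrix.eta_fin_two ((g : GLTwo R) : Matrix _ _ R)]
      simp [mMat, h]
    rw [Subgroup.coe_mul, Subgroup.coe_mul, Subgroup.coe_inv, ← hc, mul_assoc, mul_inv_cancel,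
      mul_one, hn]

/-- The projective elementary group `PE(2,R)`. -/
abbrev PE : Type _ := E R ⧸ scalars R

variable {R}

/-- `e_a`, the class of `j t_a` in `PE(2,R)`. -/
def e (a : R) : PE R :=
  QuotientGroup.mk (s := scalars R) ⟨jMat R * tMat a,
    mul_mem (Subgroup.subset_closure (Or.inr rfl))
      (Subgroup.subset_closure (Or.inl (Or.inl ⟨a, rfl⟩)))⟩

variable (R)

/-- `PE₂(2,R)`: the subgroup of `PE(2,R)` generated by all products `e_a e_b`. -/
def PE₂ : Subgroup (PE R) :=
  Subgroup.closure {g | ∃ a b : R, g = e a * e b}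

/-- `1` is in the stable range of `R`: whenever `Ra + Rb = R`, some `a + cb` is invertible. -/
def StableRangeOne : Prop :=
  ∀ a b : R, Ideal.span {a, b} = ⊤ → ∃ c : R, IsUnit (a + c * b)

/-- Any `n` translates `GL(1,R) - d` of the set of invertibles have a common element. -/
def TranslatesMeet (n : ℕ) : Prop :=
  ∀ d : Fin n → R, (⋂ i, (fun u : R => u - d i) '' {u : R | IsUnit u}).Nonempty

/-- The elements of the commutator subgroup `GL(1,R)'`, as elements of `R`. -/
def unitCommutators : Set R := (fun u : Rˣ => (u : R)) '' (commutator Rˣ : Set Rˣ)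

/-- The invertible elements of the centre of `R`. -/
def centralUnits : Set R := {z | IsUnit z ∧ z ∈ Subring.center R}

end ProjElem

/-! ### Centralizing modulo a normalized subgroup -/

namespace Subgroup

variable {G : Type*} [Group G]

/-! Lifted to `GL(2,R)`, both claims become a sandwich statement: a subgroup `N` containing a
nonscalar matrix and normalized by `E R` (first claim) or only by `EL R` (second claim) contains `EL
R`, whose image in `PE R` is `PE₂ R`.

The ring hypothesis (i) or (ii) produces a nonscalar element of `N` with invertible corner, hence
with a Gauss decomposition. Commuting it with `diag(z, z⁻¹)`, `z` central and `z² - 1` invertible,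
removes the diagonal factor and leaves some `lMat y * tMat x` in `N`. Its factors need not lie in
`N`, but they lie in the larger group `M = centralizerMod N (EL R)`; so `M` contains a transvection
`tMat a`, `a ≠ 0`.

The `level` of `M`, an additive group, is then shown to be all of `R`. If `E R` normalizes `N`, it
is stable under multiplication by units, so it is a nonzero ideal of a simple ring. If only `EL R`
does, multiplication by commutators of units is still available, and these generate `R` as a ring
when `R` is noncommutative; a field is treated by hand. Finally, one more commutator with `diag(z,
z⁻¹)` brings every transvection from `M` down to `N`. -/

/-- The elements that normalize `N` and centralize `H` modulo `N`. -/
def centralizerMod (N H : Subgroup G) : Subgroup G where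
  carrier := {g | g ∈ normalizer (N : Set G) ∧ ∀ x ∈ H, g * x * g⁻¹ * x⁻¹ ∈ N}
  one_mem' := ⟨one_mem _, fun x _ => by simp⟩
  mul_mem' := by
    rintro g h ⟨hg, hg'⟩ ⟨hh, hh'⟩
    refine ⟨mul_mem hg hh, fun x hx => ?_⟩
    have := mul_mem ((mem_normalizer_iff.mp hg _).mp (hh' x hx)) (hg' x hx)
    convert this using 1
    group
  inv_mem' := by
    rintro g ⟨hg, hg'⟩
    refine ⟨inv_mem hg, fun x hx => ?_⟩
    have := (mem_normalizer_iff''.mp hg _).mp (inv_mem (hg' x hx))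
    convert this using 1
    group

theorem le_centralizerMod {N H : Subgroup G} (hH : H ≤ normalizer (N : Set G)) :
    N ≤ centralizerMod N H := fun g hg => ⟨le_normalizer hg, fun x hx => by
  have := mul_mem hg ((mem_normalizer_iff.mp (hH hx) _).mp (inv_mem hg))
  simpa [mul_assoc] using this⟩

theorem conj_mem_centralizerMod {N H : Subgroup G} {g k : G} (hg : g ∈ centralizerMod N H)
    (hN : k ∈ normalizer (N : Set G)) (hH : k ∈ normalizer (H : Set G)) :
    k * g * k⁻¹ ∈ centralizerMod N H := by
  refine ⟨mul_mem (mul_mem hN hg.1) (inv_mem hN), fun x hx => ?_⟩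
  have := (mem_normalizer_iff.mp hN _).mp (hg.2 _ ((mem_normalizer_iff''.mp hH _).mp hx))
  convert this using 1
  group

/-- Centralizing modulo `N` can be tested on generators. -/
theorem mem_centralizerMod_closure {N : Subgroup G} {S : Set G} {g : G}
    (hN : closure S ≤ normalizer (N : Set G)) (hg : g ∈ normalizer (N : Set G))
    (h : ∀ x ∈ S, g * x * g⁻¹ * x⁻¹ ∈ N) : g ∈ centralizerMod N (closure S) := by
  refine ⟨hg, fun x hx => ?_⟩
  induction hx using closure_induction with
  | mem x hx => exact h x hx
  | one => simp
  | mul x y hx _ ihx ihy =>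
    have := mul_mem ihx ((mem_normalizer_iff.mp (hN hx) _).mp ihy)
    convert this using 1
    group
  | inv x hx ih =>
    have := (mem_normalizer_iff''.mp (hN hx) _).mp (inv_mem ih)
    convert this using 1
    group

end Subgroup

/-! ### Transvections, diagonal matrices and the group they generate -/

namespace ProjElem

variable {R : Type*} [Ring R]

/-- The lower unitriangular matrix with off-diagonal entry `a`. -/
def lMat (a : R) : GLTwo R where
  val := !![1, 0; a, 1]
  inv := !![1, 0; -a, 1]
  val_inv := by simp [Matrix.one_fin_two]
  inv_val := by simp [Matrix.one_fin_two]

/-- The antidiagonal matrix with entries `r` and `-r⁻¹`. -/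
def wMat (r : Rˣ) : GLTwo R := tMat (r : R) * lMat (-((r⁻¹ : Rˣ) : R)) * tMat (r : R)

@[simp] theorem tMat_inv (a : R) : (tMat a)⁻¹ = tMat (-a) := by
  apply Units.ext; simp [tMat]

@[simp] theorem lMat_inv (a : R) : (lMat a)⁻¹ = lMat (-a) := by
  apply Units.ext; simp [lMat]

@[simp] theorem mMat_inv (r s : Rˣ) : (mMat r s)⁻¹ = mMat r⁻¹ s⁻¹ := by
  apply Units.ext; simp [mMat]

@[simp] theorem tMat_zero : tMat (0 : R) = 1 := by
  apply Units.ext; simp [tMat, Matrix.one_fin_two]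

@[simp] theorem lMat_zero : lMat (0 : R) = 1 := by
  apply Units.ext; simp [lMat, Matrix.one_fin_two]

theorem tMat_mul (a b : R) : tMat a * tMat b = tMat (a + b) := by
  apply Units.ext; simp [tMat, add_comm]

theorem lMat_mul (a b : R) : lMat a * lMat b = lMat (a + b) := by
  apply Units.ext; simp [lMat]

theorem mMat_mul (r s r' s' : Rˣ) : mMat r s * mMat r' s' = mMat (r * r') (s * s') := by
  apply Units.ext; simp [mMat]

theorem mMat_mul_tMat (r s : Rˣ) (a : R) :
    mMat r s * tMat a = tMat (r * a * (s⁻¹ : Rˣ)) * mMat r s := by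
  apply Units.ext; simp [tMat, mMat]

theorem mMat_mul_lMat (r s : Rˣ) (a : R) :
    mMat r s * lMat a = lMat (s * a * (r⁻¹ : Rˣ)) * mMat r s := by
  apply Units.ext; simp [lMat, mMat]

theorem mMat_conj_tMat (r s : Rˣ) (a : R) :
    mMat r s * tMat a * (mMat r s)⁻¹ = tMat (r * a * (s⁻¹ : Rˣ)) := by
  rw [mMat_mul_tMat, mul_inv_cancel_right]

theorem mMat_conj_lMat (r s : Rˣ) (a : R) :
    mMat r s * lMat a * (mMat r s)⁻¹ = lMat (s * a * (r⁻¹ : Rˣ)) := by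
  rw [mMat_mul_lMat, mul_inv_cancel_right]

theorem jMat_conj_tMat (a : R) : jMat R * tMat a * (jMat R)⁻¹ = lMat a := by
  apply Units.ext; simp [jMat, tMat, lMat]

theorem jMat_conj_lMat (a : R) : jMat R * lMat a * (jMat R)⁻¹ = tMat a := by
  apply Units.ext; simp [jMat, tMat, lMat]

theorem jMat_inv : (jMat R)⁻¹ = jMat R := by
  apply Units.ext; simp [jMat]

theorem wMat_val (r : Rˣ) :
    (wMat r : Matrix (Fin 2) (Fin 2) R) = !![0, (r : R); -((r⁻¹ : Rˣ) : R), 0] := by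
  simp [wMat, tMat, lMat]

theorem wMat_conj_tMat (r : Rˣ) (a : R) :
    wMat r * tMat a * (wMat r)⁻¹ = lMat (-((r⁻¹ : Rˣ) * a * (r⁻¹ : Rˣ))) := by
  rw [mul_inv_eq_iff_eq_mul]
  apply Units.ext; simp [wMat_val, tMat, lMat]

theorem wMat_conj_lMat (r : Rˣ) (a : R) :
    wMat r * lMat a * (wMat r)⁻¹ = tMat (-(r * a * r)) := by
  rw [mul_inv_eq_iff_eq_mul]
  apply Units.ext; simp [wMat_val, tMat, lMat, mul_assoc]

theorem wMat_mul_wMat_inv (r s : Rˣ) :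
    wMat r * (wMat s)⁻¹ = mMat (r * s⁻¹) (r⁻¹ * s) := by
  rw [mul_inv_eq_iff_eq_mul]
  apply Units.ext; simp [wMat_val, mMat, mul_assoc]

variable (R)

/-- The subgroup of `GL(2,R)` generated by the elementary transvections. -/
def EL : Subgroup (GLTwo R) :=
  Subgroup.closure (Set.range (tMat : R → GLTwo R) ∪ Set.range (lMat : R → GLTwo R))

variable {R}

theorem tMat_mem_EL (a : R) : tMat a ∈ EL R := Subgroup.subset_closure (Or.inl ⟨a, rfl⟩)

theorem lMat_mem_EL (a : R) : lMat a ∈ EL R := Subgroup.subset_closure (Or.inr ⟨a, rfl⟩)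

theorem wMat_mem_EL (r : Rˣ) : wMat r ∈ EL R :=
  mul_mem (mul_mem (tMat_mem_EL _) (lMat_mem_EL _)) (tMat_mem_EL _)

theorem mMat_inv_mem_EL (r : Rˣ) : mMat r r⁻¹ ∈ EL R := by
  have := mul_mem (wMat_mem_EL r) (inv_mem (wMat_mem_EL (1 : Rˣ)))
  rwa [wMat_mul_wMat_inv, inv_one, mul_one, mul_one] at this

theorem EL_le {H : Subgroup (GLTwo R)} (ht : ∀ a, tMat a ∈ H) (hl : ∀ a, lMat a ∈ H) :
    EL R ≤ H := by
  rw [EL, Subgroup.closure_le]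
  rintro _ (⟨a, rfl⟩ | ⟨a, rfl⟩)
  exacts [ht a, hl a]

theorem mem_normalizer_EL {k : GLTwo R}
    (ht : ∀ a, k * tMat a * k⁻¹ ∈ EL R) (hl : ∀ a, k * lMat a * k⁻¹ ∈ EL R)
    (ht' : ∀ a, k⁻¹ * tMat a * k ∈ EL R) (hl' : ∀ a, k⁻¹ * lMat a * k ∈ EL R) :
    k ∈ Subgroup.normalizer (EL R : Set (GLTwo R)) := by
  rw [Subgroup.mem_normalizer_iff]
  refine fun h => ⟨fun hh => ?_, fun hh => ?_⟩
  · exact EL_le (H := (EL R).comap (MulAut.conj k).toMonoidHom) ht hl hh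
  · have := EL_le (H := (EL R).comap (MulAut.conj k⁻¹).toMonoidHom)
      (fun a => by simpa using ht' a) (fun a => by simpa using hl' a) hh
    simpa [mul_assoc] using this

/-- Diagonal matrices rescale transvections and `jMat` exchanges upper with lower ones. -/
theorem E_le_normalizer_EL : E R ≤ Subgroup.normalizer (EL R : Set (GLTwo R)) := by
  rw [E, Subgroup.closure_le]
  rintro _ ((⟨a, rfl⟩ | ⟨⟨r, s⟩, rfl⟩) | rfl)
  · exact Subgroup.le_normalizer (tMat_mem_EL a)
  · have h := fun a => mMat_conj_tMat r⁻¹ s⁻¹ a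
    have h' := fun a => mMat_conj_lMat r⁻¹ s⁻¹ a
    simp only [← mMat_inv, inv_inv] at h h'
    refine mem_normalizer_EL (fun a => ?_) (fun a => ?_) (fun a => ?_) (fun a => ?_)
    · exact mMat_conj_tMat r s a ▸ tMat_mem_EL _
    · exact mMat_conj_lMat r s a ▸ lMat_mem_EL _
    · exact h a ▸ tMat_mem_EL _
    · exact h' a ▸ lMat_mem_EL _
  · have h := fun a : R => jMat_conj_tMat a
    have h' := fun a : R => jMat_conj_lMat a
    refine mem_normalizer_EL (fun a => h a ▸ lMat_mem_EL _) (fun a => h' a ▸ tMat_mem_EL _)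
      (fun a => ?_) (fun a => ?_)
    · have := h a
      rw [jMat_inv] at this ⊢
      exact this ▸ lMat_mem_EL _
    · have := h' a
      rw [jMat_inv] at this ⊢
      exact this ▸ tMat_mem_EL _

/-! ### Gauss decomposition, central units and scalars -/

/-- A matrix with invertible upper left entry has a Gauss decomposition. -/
theorem exists_eq_lMat_mul_mMat_mul_tMat (g : GLTwo R) (h : IsUnit (g.val 0 0)) :
    ∃ (y x : R) (r s : Rˣ), g = lMat y * mMat r s * tMat x := by
  obtain ⟨u, hu⟩ := h
  set b := g.val 0 1 with hb
  set c := g.val 1 0 with hc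
  set d := g.val 1 1 with hd
  have hg : g.val = !![(u : R), b; c, d] := by
    rw [hu, hb, hc, hd]; exact Matrix.eta_fin_two _
  set k : GLTwo R := lMat (-(c * (u⁻¹ : Rˣ))) * g * tMat (-((u⁻¹ : Rˣ) * b)) with hk
  have hkv : k.val = !![(u : R), 0; 0, d - c * (u⁻¹ : Rˣ) * b] := by
    simp [hk, hg, lMat, tMat, mul_assoc]
    abel
  have hki := Matrix.eta_fin_two (k⁻¹).val
  have h₁ := k.val_inv
  have h₂ := k.inv_val
  change k.val * (k⁻¹).val = 1 at h₁
  change (k⁻¹).val * k.val = 1 at h₂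
  rw [hkv, hki] at h₁ h₂
  have e₁ := congrFun (congrFun h₁ 1) 1
  have e₂ := congrFun (congrFun h₂ 1) 1
  simp at e₁ e₂
  refine ⟨c * (u⁻¹ : Rˣ), (u⁻¹ : Rˣ) * b, u, ⟨_, _, e₁, e₂⟩, ?_⟩
  have : k = mMat u ⟨_, _, e₁, e₂⟩ := by
    apply Units.ext; rw [hkv]; rfl
  rw [← this, hk, ← lMat_inv, ← tMat_inv]
  group

theorem isUnit_of_mem_center [IsSimpleRing R] {x : R} (hx : x ∈ Subring.center R) (h : x ≠ 0) :
    IsUnit x := by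
  obtain ⟨y, hy⟩ := (IsSimpleRing.isField_center R).mul_inv_cancel
    (a := ⟨x, hx⟩) (by simpa [Subtype.ext_iff] using h)
  have hxy : x * y = 1 := congrArg Subtype.val hy
  exact ⟨⟨x, y, hxy, by rw [← hxy]; exact Subring.mem_center_iff.mp hx _⟩, rfl⟩

/-- The centre is a field with an element other than `0, 1, -1`, and `z² - 1 = (z - 1)(z + 1)`. -/
theorem exists_center_unit [IsSimpleRing R] (hcentre : 4 ≤ ENat.card (Subring.center R)) :
    ∃ z : Rˣ, (z : R) ∈ Subring.center R ∧ (z : R) ≠ 1 ∧ IsUnit ((z : R) * z - 1) := by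
  classical
  have : ∃ x : Subring.center R, x ≠ 0 ∧ x ≠ 1 ∧ x ≠ -1 := by
    by_contra! hcon
    have hsub : (Set.univ : Set (Subring.center R)) ⊆ ({0, 1, -1} : Finset (Subring.center R)) := by
      intro x _
      by_cases h0 : x = 0
      · simp [h0]
      by_cases h1 : x = 1
      · simp [h1]
      simp [hcon x h0 h1]
    have h1 := Set.encard_le_encard hsub
    rw [Set.encard_univ, Set.encard_coe_eq_coe_finsetCard] at h1
    have h2 : (4 : ℕ∞) ≤ ((3 : ℕ) : ℕ∞) :=
      (hcentre.trans h1).trans (by exact_mod_cast Finset.card_le_three)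
    exact absurd (by exact_mod_cast h2 : (4 : ℕ) ≤ 3) (by norm_num)
  obtain ⟨⟨x, hx⟩, h0, h1, h2⟩ := this
  simp only [ne_eq, Subtype.ext_iff, ZeroMemClass.coe_zero, OneMemClass.coe_one,
    NegMemClass.coe_neg] at h0 h1 h2
  obtain ⟨z, rfl⟩ := isUnit_of_mem_center hx h0
  refine ⟨z, hx, h1, ?_⟩
  have e : (z : R) * z - 1 = (z - 1) * (z + 1) := by noncomm_ring
  rw [e]
  exact (isUnit_of_mem_center (sub_mem hx (one_mem _)) (sub_ne_zero.mpr h1)).mul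
    (isUnit_of_mem_center (add_mem hx (one_mem _)) (fun h => h2 (eq_neg_of_add_eq_zero_left h)))

/-- Being a scalar matrix with central entry. -/
def IsScalar (g : GLTwo R) : Prop := ∃ z : Rˣ, (z : R) ∈ Subring.center R ∧ g = mMat z z

theorem IsScalar.commute {g : GLTwo R} (hg : IsScalar g) (h : GLTwo R) : g * h = h * g := by
  obtain ⟨z, hz, rfl⟩ := hg
  apply Units.ext
  have hc := fun x : R => (Subring.mem_center_iff.mp hz x).symm
  rw [Units.val_mul, Units.val_mul, Matrix.eta_fin_two h.val]
  simp [mMat, hc]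

theorem IsScalar.of_conj {g k : GLTwo R} (h : IsScalar (k * g * k⁻¹)) : IsScalar g := by
  have := h.commute k
  have e : k * g * k⁻¹ = g := by
    rw [inv_mul_cancel_right] at this
    exact (mul_left_cancel this).symm
  rwa [e] at h

/-! ### From a nonscalar element to a transvection -/

/-- Since `tMat x` commutes with `tMat b`, the commutator of `lMat y` with `tMat b` equals that of
the whole product, hence lies in `N`; with lower transvections `lMat y` commutes outright. -/
theorem lMat_mem_and_tMat_mem {N : Subgroup (GLTwo R)}
    (hN : EL R ≤ Subgroup.normalizer (N : Set (GLTwo R))) {y x : R}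
    (h : lMat y * tMat x ∈ N) :
    lMat y ∈ Subgroup.centralizerMod N (EL R) ∧ tMat x ∈ Subgroup.centralizerMod N (EL R) := by
  have key : lMat y ∈ Subgroup.centralizerMod N (EL R) := by
    refine Subgroup.mem_centralizerMod_closure hN (hN (lMat_mem_EL y)) ?_
    rintro _ (⟨b, rfl⟩ | ⟨b, rfl⟩)
    · have h₁ := mul_mem h ((Subgroup.mem_normalizer_iff.mp (hN (tMat_mem_EL b)) _).mp (inv_mem h))
      convert h₁ using 1
      have hc : tMat b = tMat x * tMat b * (tMat x)⁻¹ := by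
        rw [tMat_inv, tMat_mul, tMat_mul, add_neg_cancel_comm]
      calc lMat y * tMat b * (lMat y)⁻¹ * (tMat b)⁻¹
          = lMat y * (tMat x * tMat b * (tMat x)⁻¹) * (lMat y)⁻¹ * (tMat b)⁻¹ := by rw [← hc]
        _ = _ := by group
    · rw [lMat_inv, lMat_inv, lMat_mul, lMat_mul, lMat_mul]
      simp
  refine ⟨key, ?_⟩
  have := mul_mem (inv_mem key) (Subgroup.le_centralizerMod hN h)
  rwa [inv_mul_cancel_left] at this

theorem tMat_mem_of_lMat_mem {N : Subgroup (GLTwo R)}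
    (hN : EL R ≤ Subgroup.normalizer (N : Set (GLTwo R))) {y : R}
    (h : lMat y ∈ Subgroup.centralizerMod N (EL R)) :
    tMat y ∈ Subgroup.centralizerMod N (EL R) := by
  have := inv_mem (Subgroup.conj_mem_centralizerMod h (hN (wMat_mem_EL 1))
    (Subgroup.le_normalizer (wMat_mem_EL 1)))
  rw [wMat_conj_lMat] at this
  simpa using this

theorem lMat_mem_of_tMat_mem {N : Subgroup (GLTwo R)}
    (hN : EL R ≤ Subgroup.normalizer (N : Set (GLTwo R))) {y : R}
    (h : tMat y ∈ Subgroup.centralizerMod N (EL R)) :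
    lMat y ∈ Subgroup.centralizerMod N (EL R) := by
  have := inv_mem (Subgroup.conj_mem_centralizerMod h (hN (wMat_mem_EL 1))
    (Subgroup.le_normalizer (wMat_mem_EL 1)))
  rw [wMat_conj_tMat] at this
  simpa using this

theorem exists_tMat_mem_of_isUnit [IsSimpleRing R]
    (hcentre : 4 ≤ ENat.card (Subring.center R)) {N : Subgroup (GLTwo R)}
    (hN : EL R ≤ Subgroup.normalizer (N : Set (GLTwo R))) {g : GLTwo R} (hg : g ∈ N)
    (hns : ¬ IsScalar g) (hu : IsUnit (g.val 0 0)) :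
    ∃ a : R, a ≠ 0 ∧ tMat a ∈ Subgroup.centralizerMod N (EL R) := by
  obtain ⟨y, x, r, s, rfl⟩ := exists_eq_lMat_mul_mMat_mul_tMat g hu
  by_cases hxy : y = 0 ∧ x = 0
  · obtain ⟨rfl, rfl⟩ := hxy
    simp only [lMat_zero, tMat_zero, one_mul, mul_one] at hg hns
    -- Otherwise `b = 1` forces `r = s`, and the other `b` force `r` to be central.
    have hex : ∃ b : R, r * b * (s⁻¹ : Rˣ) - b ≠ 0 := by
      by_contra! hcon
      have hrs : r = s := by
        have := hcon 1
        rw [mul_one, sub_eq_zero, Units.mul_inv_eq_iff_eq_mul, one_mul] at this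
        exact Units.ext this
      subst hrs
      refine hns ⟨r, Subring.mem_center_iff.mpr fun b => ?_, rfl⟩
      have := hcon b
      rw [sub_eq_zero, Units.mul_inv_eq_iff_eq_mul] at this
      exact this.symm
    obtain ⟨b, hb⟩ := hex
    refine ⟨_, hb, Subgroup.le_centralizerMod hN ?_⟩
    have := mul_mem hg
      ((Subgroup.mem_normalizer_iff.mp (hN (tMat_mem_EL b)) _).mp (inv_mem hg))
    rw [← mul_assoc, ← mul_assoc, mMat_conj_tMat, tMat_inv, tMat_mul, ← sub_eq_add_neg] at this
    exact this
  · obtain ⟨z, hz, -, v, hv⟩ := exists_center_unit hcentre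
    have hc : ∀ b : R, b * z = z * b := Subring.mem_center_iff.mp hz
    have hc' : ∀ b : R, b * (z⁻¹ : Rˣ) = (z⁻¹ : Rˣ) * b := fun b => by
      rw [Units.eq_inv_mul_iff_mul_eq, ← mul_assoc, ← hc, Units.mul_inv_cancel_right]
    set n := mMat z z⁻¹ with hn
    set p := lMat y * mMat r s * tMat x with hp
    have hnm : n * mMat r s = mMat r s * n := by
      rw [hn, mMat_mul, mMat_mul]
      congr 1 <;> ext <;> push_cast
      · exact (hc _).symm
      · exact (hc' _).symm
    have hnE : n ∈ EL R := mMat_inv_mem_EL z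
    have h₁ := mul_mem (inv_mem hg) ((Subgroup.mem_normalizer_iff.mp (hN hnE) _).mp hg)
    -- Conjugating by `tMat x` cancels the right factor of `p⁻¹`, so that a lower times an upper
    -- transvection remains.
    have h₂ := (Subgroup.mem_normalizer_iff.mp (hN (tMat_mem_EL x)) _).mp h₁
    have hconj : n * p * n⁻¹ =
        lMat ((z⁻¹ : Rˣ) * y * (z⁻¹ : Rˣ)) * mMat r s * tMat (z * x * z) := by
      have e₁ := mMat_conj_lMat z z⁻¹ y
      have e₂ := mMat_conj_tMat z z⁻¹ x
      rw [inv_inv] at e₂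
      rw [← e₁, ← e₂, ← hn, hp]
      calc n * (lMat y * mMat r s * tMat x) * n⁻¹
          = n * lMat y * n⁻¹ * (n * mMat r s) * tMat x * n⁻¹ := by group
        _ = n * lMat y * n⁻¹ * (mMat r s * n) * tMat x * n⁻¹ := by rw [hnm]
        _ = _ := by group
    have h₃ : tMat x * (p⁻¹ * (n * p * n⁻¹)) * (tMat x)⁻¹ =
        lMat ((s⁻¹ : Rˣ) * ((z⁻¹ : Rˣ) * y * (z⁻¹ : Rˣ) - y) * r) * tMat (z * x * z - x) := by
      have e₁ := mMat_conj_lMat r⁻¹ s⁻¹ ((z⁻¹ : Rˣ) * y * (z⁻¹ : Rˣ) - y)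
      rw [inv_inv] at e₁
      rw [hconj, hp, ← e₁, ← mMat_inv, inv_inv, sub_eq_neg_add, sub_eq_add_neg, ← lMat_mul,
        ← tMat_mul, ← lMat_inv, ← tMat_inv]
      group
    rw [h₃] at h₂
    obtain ⟨hl, ht⟩ := lMat_mem_and_tMat_mem hN h₂
    by_cases hx : x = 0
    · refine ⟨_, ?_, tMat_mem_of_lMat_mem hN hl⟩
      have hy : y ≠ 0 := fun hy => hxy ⟨hy, hx⟩
      intro h0
      rw [Units.mul_left_eq_zero, Units.mul_right_eq_zero] at h0
      apply hy
      have : (v : R) * y = 0 := by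
        rw [hv, sub_mul, one_mul]
        have h5 := congrArg (fun b : R => -(z * b * z)) h0
        simp only [mul_sub, sub_mul, mul_assoc, Units.inv_mul, mul_one, Units.mul_inv_cancel_left,
          mul_zero, zero_mul, neg_zero, hc y] at h5
        rw [mul_assoc, ← h5]
        abel
      simpa using this
    · refine ⟨_, ?_, ht⟩
      intro h0
      apply hx
      have : (v : R) * x = 0 := by
        rw [hv, sub_mul, one_mul, ← h0, mul_assoc, mul_assoc, hc x]
      simpa using this

/-! ### Producing an invertible corner -/

/-- With `x = u⁻¹`, this is the fact that `1 + ba` invertible implies `1 + ab` invertible, for `b =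
u⁻¹c`. -/
theorem isUnit_one_add_mul_mul {a c u : R} (hu : IsUnit u) (h : IsUnit (u + c * a)) :
    ∃ x : Rˣ, IsUnit (1 + a * x * c) := by
  obtain ⟨u, rfl⟩ := hu
  refine ⟨u⁻¹, ?_⟩
  have h₁ : IsUnit (1 + ((u⁻¹ : Rˣ) * c) * a) := by
    have := (u⁻¹).isUnit.mul h
    rwa [mul_add, Units.inv_mul, ← mul_assoc] at this
  obtain ⟨w, hw⟩ := h₁
  set b : R := (u⁻¹ : Rˣ) * c with hb
  have e₁ : (1 + b * a) * (w⁻¹ : Rˣ) = 1 := by rw [← hw]; simp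
  have e₂ : (w⁻¹ : Rˣ) * (1 + b * a) = 1 := by rw [← hw]; simp
  rw [mul_assoc, ← hb]
  refine ⟨⟨1 + a * b, 1 - a * (w⁻¹ : Rˣ) * b, ?_, ?_⟩, rfl⟩
  · calc (1 + a * b) * (1 - a * (w⁻¹ : Rˣ) * b)
        = 1 + a * b - a * ((1 + b * a) * (w⁻¹ : Rˣ)) * b := by noncomm_ring
      _ = 1 := by rw [e₁]; noncomm_ring
  · calc (1 - a * (w⁻¹ : Rˣ) * b) * (1 + a * b)
        = 1 + a * b - a * ((w⁻¹ : Rˣ) * (1 + b * a)) * b := by noncomm_ring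
      _ = 1 := by rw [e₂]; noncomm_ring

/-- The first column of `g` is left unimodular, and conjugation by `tMat x` turns the corner `a`
into `a + xc`. -/
theorem exists_isUnit_of_stableRangeOne (hR : StableRangeOne R) {N : Subgroup (GLTwo R)}
    (hN : EL R ≤ Subgroup.normalizer (N : Set (GLTwo R))) {g : GLTwo R} (hg : g ∈ N)
    (hns : ¬ IsScalar g) : ∃ f ∈ N, ¬ IsScalar f ∧ IsUnit (f.val 0 0) := by
  have hgv := Matrix.eta_fin_two g.val
  have hspan : Ideal.span {g.val 0 0, g.val 1 0} = ⊤ := by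
    rw [Ideal.eq_top_iff_one, Ideal.mem_span_pair]
    refine ⟨(g⁻¹).val 0 0, (g⁻¹).val 0 1, ?_⟩
    have := congrFun (congrFun (Units.inv_mul g) 0) 0
    rwa [Matrix.mul_apply, Fin.sum_univ_two, Matrix.one_apply_eq] at this
  obtain ⟨x, hx⟩ := hR _ _ hspan
  refine ⟨tMat x * g * (tMat x)⁻¹,
    (Subgroup.mem_normalizer_iff.mp (hN (tMat_mem_EL x)) _).mp hg, fun h => hns h.of_conj, ?_⟩
  rw [tMat_inv, Units.val_mul, Units.val_mul, hgv]
  simpa [tMat] using hx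

/-- The commutator of `g` with `tMat x` has corner `1 + a x c'`, where `c'` is an entry of `g⁻¹`; a
suitable unit `x` makes this invertible. Should the commutator be scalar, `g` itself has an
invertible corner. -/
theorem exists_isUnit_of_translatesMeet [IsSimpleRing R] (hR : TranslatesMeet R 3)
    {N : Subgroup (GLTwo R)}
    (hN : EL R ≤ Subgroup.normalizer (N : Set (GLTwo R))) {g : GLTwo R} (hg : g ∈ N)
    (hns : ¬ IsScalar g) : ∃ f ∈ N, ¬ IsScalar f ∧ IsUnit (f.val 0 0) := by
  have hgv := Matrix.eta_fin_two g.val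
  have hiv := Matrix.eta_fin_two (g⁻¹).val
  have hgi := Units.mul_inv g
  have hig := Units.inv_mul g
  set a := g.val 0 0
  set b := g.val 0 1
  set c := g.val 1 0
  set d := g.val 1 1
  set a' := (g⁻¹).val 0 0
  set b' := (g⁻¹).val 0 1
  set c' := (g⁻¹).val 1 0
  set d' := (g⁻¹).val 1 1
  -- Two translates suffice: `u` and `u + c' * a` are to be units. The third is padding.
  obtain ⟨u, hu⟩ := hR ![0, c' * a, 0]
  rw [Set.mem_iInter] at hu
  obtain ⟨u₀, hu₀, e₀⟩ := hu 0
  obtain ⟨u₁, hu₁, e₁⟩ := hu 1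
  simp at e₀ e₁ hu₀ hu₁
  subst e₀
  have hu₂ : IsUnit (u₀ + c' * a) := by rwa [← e₁, sub_add_cancel]
  obtain ⟨x, hx⟩ := isUnit_one_add_mul_mul hu₀ hu₂
  have hf : g * tMat (x : R) * g⁻¹ * (tMat (x : R))⁻¹ ∈ N := by
    have := mul_mem hg
      ((Subgroup.mem_normalizer_iff.mp (hN (tMat_mem_EL (x : R))) _).mp (inv_mem hg))
    simpa only [mul_assoc] using this
  by_cases hs : IsScalar (g * tMat (x : R) * g⁻¹ * (tMat (x : R))⁻¹)
  · obtain ⟨z, hz, hs⟩ := hs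
    rw [mul_inv_eq_iff_eq_mul, mul_inv_eq_iff_eq_mul] at hs
    have hv : g.val * (tMat (x : R)).val = (mMat z z).val * (tMat (x : R)).val * g.val :=
      congrArg Units.val hs
    rw [hgv] at hv
    have q₀ := congrFun (congrFun hv 0) 0
    have q₁ := congrFun (congrFun hv 1) 0
    have q₂ := congrFun (congrFun hv 0) 1
    simp [tMat, mMat] at q₀ q₁ q₂
    have haa : a' * a + b' * c = 1 := by
      have := congrFun (congrFun hig 0) 0
      rwa [Matrix.mul_apply, Fin.sum_univ_two, Matrix.one_apply_eq] at this
    have hdd : c * b' + d * d' = 1 := by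
      have := congrFun (congrFun hgi 1) 1
      rwa [Matrix.mul_apply, Fin.sum_univ_two, Matrix.one_apply_eq] at this
    have hz1 : (z : R) = 1 := by
      by_contra hne
      have hw := isUnit_of_mem_center (sub_mem hz (one_mem _)) (sub_ne_zero.mpr hne)
      have hc0 : c = 0 := by
        rw [← hw.mul_right_eq_zero, sub_mul, one_mul, ← q₁, sub_self]
      rw [hc0, mul_zero, add_zero] at q₀
      have ha0 : a = 0 := by
        rw [← hw.mul_right_eq_zero, sub_mul, one_mul, ← q₀, sub_self]
      rw [hc0, ha0, mul_zero, mul_zero, add_zero] at haa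
      exact zero_ne_one haa
    simp [hz1] at q₀ q₂
    rw [q₀, mul_zero, add_zero] at haa
    rw [q₀, zero_mul, zero_add] at hdd
    have hax : a * x = x * d := by
      rw [add_comm] at q₂
      exact add_left_cancel q₂
    refine ⟨g, hg, hns, ?_⟩
    -- Now `g` is upper triangular with `a = x d x⁻¹`: `a` has a left inverse from `g⁻¹ g = 1`, and
    -- `d` a right inverse from `g g⁻¹ = 1`.
    have hr : a * (x * d' * (x⁻¹ : Rˣ)) = 1 := by
      rw [← mul_assoc, ← mul_assoc, hax, mul_assoc (x : R) d d', hdd, mul_one, Units.mul_inv]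
    have hl : a' = x * d' * (x⁻¹ : Rˣ) := left_inv_eq_right_inv haa hr
    exact ⟨⟨a, a', by rw [hl, hr], haa⟩, rfl⟩
  · refine ⟨_, hf, hs, ?_⟩
    have haa : a * a' + b * c' = 1 := by
      have := congrFun (congrFun hgi 0) 0
      rwa [Matrix.mul_apply, Fin.sum_univ_two, Matrix.one_apply_eq] at this
    have : (g * tMat (x : R) * g⁻¹ * (tMat (x : R))⁻¹).val 0 0 = 1 + a * x * c' := by
      rw [tMat_inv, Units.val_mul, Units.val_mul, Units.val_mul, hgv, hiv]
      simp [tMat]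
      rw [← haa]
      noncomm_ring
    rwa [this]

/-- The commutator of `tMat a` with `diag(z, z⁻¹)` is a transvection with entry `±(z² - 1)a`, and
`z² - 1` is invertible. -/
theorem EL_le_of_forall_tMat_mem [IsSimpleRing R]
    (hcentre : 4 ≤ ENat.card (Subring.center R)) {N : Subgroup (GLTwo R)}
    (hN : EL R ≤ Subgroup.normalizer (N : Set (GLTwo R)))
    (h : ∀ a : R, tMat a ∈ Subgroup.centralizerMod N (EL R)) : EL R ≤ N := by
  obtain ⟨z, hz, -, v, hv⟩ := exists_center_unit hcentre
  have ht : ∀ b : R, tMat b ∈ N := fun b => by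
    have := inv_mem ((h ((v⁻¹ : Rˣ) * b)).2 _ (mMat_inv_mem_EL z))
    have e : mMat z z⁻¹ * tMat ((v⁻¹ : Rˣ) * b) * (mMat z z⁻¹)⁻¹ * (tMat ((v⁻¹ : Rˣ) * b))⁻¹
        = tMat b := by
      rw [mMat_conj_tMat, tMat_inv, tMat_mul, inv_inv, mul_assoc (z : R),
        Subring.mem_center_iff.mp hz, ← mul_assoc (z : R), ← sub_eq_add_neg, ← sub_one_mul, ← hv,
        Units.mul_inv_cancel_left]
    rw [← e]
    convert this using 1
    group
  refine EL_le ht fun b => ?_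
  have := inv_mem ((Subgroup.mem_normalizer_iff.mp (hN (wMat_mem_EL 1)) _).mp (ht b))
  rw [wMat_conj_tMat] at this
  simpa using this

theorem exists_tMat_mem [IsSimpleRing R]
    (hcentre : 4 ≤ ENat.card (Subring.center R))
    (hR : StableRangeOne R ∨ TranslatesMeet R 3) {N : Subgroup (GLTwo R)}
    (hN : EL R ≤ Subgroup.normalizer (N : Set (GLTwo R))) {g : GLTwo R} (hg : g ∈ N)
    (hns : ¬ IsScalar g) :
    ∃ a : R, a ≠ 0 ∧ tMat a ∈ Subgroup.centralizerMod N (EL R) := by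
  obtain ⟨f, hf, hfs, hfu⟩ := hR.elim
    (fun h => exists_isUnit_of_stableRangeOne h hN hg hns)
    (fun h => exists_isUnit_of_translatesMeet h hN hg hns)
  exact exists_tMat_mem_of_isUnit hcentre hN hf hfs hfu

/-! ### Levels, and subgroups normalized by `E R` -/

/-- The additive group of all `a` with `t_a ∈ M`. -/
def level (M : Subgroup (GLTwo R)) : AddSubgroup R where
  carrier := {a | tMat a ∈ M}
  zero_mem' := by simp [one_mem]
  add_mem' := fun {a b} ha hb => by
    have ha' : tMat a ∈ M := ha
    have hb' : tMat b ∈ M := hb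
    have := mul_mem ha' hb'
    rwa [tMat_mul] at this
  neg_mem' := fun {a} ha => by
    have ha' : tMat a ∈ M := ha
    have := inv_mem ha'
    rwa [tMat_inv] at this

theorem mem_level {M : Subgroup (GLTwo R)} {a : R} : a ∈ level M ↔ tMat a ∈ M := Iff.rfl

/-- In a simple ring, an additive subgroup containing `R a R` for some `a ≠ 0` is everything. -/
theorem eq_top_of_forall_mul_mem [IsSimpleRing R] (A : AddSubgroup R) {a : R} (ha : a ≠ 0)
    (h : ∀ r s : R, r * a * s ∈ A) : A = ⊤ := by
  let I : TwoSidedIdeal R := TwoSidedIdeal.mk' {c | ∀ r s : R, r * c * s ∈ A}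
    (fun r s => by simp [zero_mem])
    (fun {x y} hx hy r s => by
      rw [mul_add, add_mul]
      exact add_mem (hx r s) (hy r s))
    (fun {x} hx r s => by
      rw [mul_neg, neg_mul]
      exact neg_mem (hx r s))
    (fun {x y} hy r s => by
      rw [← mul_assoc]
      exact hy _ s)
    (fun {x y} hx r s => by
      rw [← mul_assoc, mul_assoc _ y s]
      exact hx r _)
  have hI : ∀ c, c ∈ I ↔ ∀ r s : R, r * c * s ∈ A := fun c => by
    simp only [I, TwoSidedIdeal.mem_mk', Set.mem_ofPred_eq]
  have h1 : (1 : R) ∈ I := IsSimpleRing.one_mem_of_ne_zero_mem I ha ((hI a).mpr h)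
  rw [eq_top_iff]
  intro x _
  simpa using (hI 1).mp h1 x 1

/-- If a set generates `R` as a ring and preserves an additive subgroup by left and right
multiplication, then so does all of `R`. -/
theorem mul_mul_mem_of_closure_eq_top {U : Set R} (hU : Subring.closure U = ⊤) (A : AddSubgroup R)
    (hl : ∀ u ∈ U, ∀ a ∈ A, u * a ∈ A) (hr : ∀ u ∈ U, ∀ a ∈ A, a * u ∈ A) {a : R} (ha : a ∈ A)
    (r s : R) : r * a * s ∈ A := by
  have hl' : ∀ x : R, ∀ a ∈ A, x * a ∈ A := fun x => by
    have hx : x ∈ Subring.closure U := hU ▸ Subring.mem_top x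
    induction hx using Subring.closure_induction with
    | mem x hx => exact hl x hx
    | zero => simp [zero_mem]
    | one => simp
    | add x y _ _ hx hy => exact fun a ha => by rw [add_mul]; exact add_mem (hx a ha) (hy a ha)
    | neg x _ hx => exact fun a ha => by rw [neg_mul]; exact neg_mem (hx a ha)
    | mul x y _ _ hx hy => exact fun a ha => by rw [mul_assoc]; exact hx _ (hy a ha)
  have hr' : ∀ x : R, ∀ a ∈ A, a * x ∈ A := fun x => by
    have hx : x ∈ Subring.closure U := hU ▸ Subring.mem_top x
    induction hx using Subring.closure_induction with
    | mem x hx => exact hr x hx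
    | zero => simp [zero_mem]
    | one => simp
    | add x y _ _ hx hy => exact fun a ha => by rw [mul_add]; exact add_mem (hx a ha) (hy a ha)
    | neg x _ hx => exact fun a ha => by rw [mul_neg]; exact neg_mem (hx a ha)
    | mul x y _ _ hx hy => exact fun a ha => by rw [← mul_assoc]; exact hy _ (hx a ha)
  exact hr' s _ (hl' r a ha)

theorem tMat_mem_E (a : R) : tMat a ∈ E R := Subgroup.subset_closure (Or.inl (Or.inl ⟨a, rfl⟩))

theorem mMat_mem_E (r s : Rˣ) : mMat r s ∈ E R :=
  Subgroup.subset_closure (Or.inl (Or.inr ⟨(r, s), rfl⟩))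

theorem jMat_mem_E : jMat R ∈ E R := Subgroup.subset_closure (Or.inr rfl)

theorem lMat_mem_E (a : R) : lMat a ∈ E R :=
  jMat_conj_tMat a ▸ mul_mem (mul_mem jMat_mem_E (tMat_mem_E a)) (inv_mem jMat_mem_E)

theorem EL_le_E : EL R ≤ E R := EL_le tMat_mem_E lMat_mem_E

/-- A subgroup normalized by `E(2,R)` with a nonscalar element contains all transvections. -/
theorem EL_le_of_E_le_normalizer [IsSimpleRing R]
    (hcentre : 4 ≤ ENat.card (Subring.center R))
    (hgen : Subring.closure {u : R | IsUnit u} = ⊤)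
    (hR : StableRangeOne R ∨ TranslatesMeet R 3) {N : Subgroup (GLTwo R)}
    (hN : E R ≤ Subgroup.normalizer (N : Set (GLTwo R))) {g : GLTwo R} (hg : g ∈ N)
    (hns : ¬ IsScalar g) : EL R ≤ N := by
  have hN' := EL_le_E.trans hN
  obtain ⟨a, ha, haM⟩ := exists_tMat_mem hcentre hR hN' hg hns
  have hconj : ∀ (r s : Rˣ), ∀ b ∈ level (Subgroup.centralizerMod N (EL R)),
      r * b * (s⁻¹ : Rˣ) ∈ level (Subgroup.centralizerMod N (EL R)) := fun r s b hb => by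
    have := Subgroup.conj_mem_centralizerMod (mem_level.mp hb) (hN (mMat_mem_E r s))
      (E_le_normalizer_EL (mMat_mem_E r s))
    rwa [mMat_conj_tMat] at this
  have htop := eq_top_of_forall_mul_mem (level (Subgroup.centralizerMod N (EL R))) ha
    (mul_mul_mem_of_closure_eq_top hgen _
      (by rintro _ ⟨u, rfl⟩ b hb; simpa using hconj u 1 b hb)
      (by rintro _ ⟨u, rfl⟩ b hb; simpa using hconj 1 u⁻¹ b hb) haM)
  exact EL_le_of_forall_tMat_mem hcentre hN' fun b =>
    mem_level.mp (htop ▸ AddSubgroup.mem_top b)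

/-! ### Subgroups normalized only by `EL R` -/

theorem mMat_one_right_mem_EL {k : Rˣ} (hk : k ∈ commutator Rˣ) : mMat k 1 ∈ EL R := by
  have h1 : ∀ r s : Rˣ, mMat (r * s * r⁻¹ * s⁻¹) 1 ∈ EL R := fun r s => by
    -- In `diag(rs, (rs)⁻¹) diag(r⁻¹, r) diag(s⁻¹, s)` the lower entry cancels and the upper one is
    -- the commutator.
    have := mul_mem (mul_mem (mMat_inv_mem_EL (r * s)) (mMat_inv_mem_EL r⁻¹)) (mMat_inv_mem_EL s⁻¹)
    rw [mMat_mul, mMat_mul] at this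
    convert this using 2
    group
  rw [commutator_eq_closure] at hk
  induction hk using Subgroup.closure_induction with
  | mem x hx =>
    obtain ⟨r, s, rfl⟩ := hx
    exact h1 r s
  | one =>
    convert one_mem (EL R)
    simpa using mMat_mul (1 : Rˣ) 1 1 1
  | mul x y _ _ hx hy => simpa [mMat_mul] using mul_mem hx hy
  | inv x _ hx => simpa using inv_mem hx

/-- In a noncommutative simple ring, central units are redundant in additive generation by
commutators of units and central units. -/
theorem closure_unitCommutators_eq_top [IsSimpleRing R]
    (h : AddSubgroup.closure (unitCommutators R ∪ centralUnits R) = ⊤)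
    (hnc : ∃ a b : R, a * b ≠ b * a) : Subring.closure (unitCommutators R) = ⊤ := by
  set S := Subring.closure (unitCommutators R) with hS
  have hdec : ∀ x : R, ∃ s ∈ S, ∃ z ∈ Subring.center R, x = s + z := fun x => by
    have hx : x ∈ AddSubgroup.closure (unitCommutators R ∪ centralUnits R) :=
      h ▸ AddSubgroup.mem_top x
    have hle : AddSubgroup.closure (unitCommutators R ∪ centralUnits R) ≤
        S.toAddSubgroup ⊔ (Subring.center R).toAddSubgroup := by
      rw [AddSubgroup.closure_le]
      rintro y (hy | hy)
      · exact AddSubgroup.mem_sup_left (Subring.subset_closure hy)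
      · exact AddSubgroup.mem_sup_right hy.2
    obtain ⟨s, hs, z, hz, e⟩ := AddSubgroup.mem_sup.mp (hle hx)
    exact ⟨s, hs, z, hz, e.symm⟩
  obtain ⟨a, b, hab⟩ := hnc
  obtain ⟨s, hs, z, hz, rfl⟩ := hdec a
  obtain ⟨t, ht, w, hw, rfl⟩ := hdec b
  have hc := fun {z : R} (hz : z ∈ Subring.center R) (x : R) => Subring.mem_center_iff.mp hz x
  -- Central summands do not affect commutators, so a nonzero commutator already occurs inside `S`.
  have hne : s * t - t * s ≠ 0 := fun h0 => hab <| by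
    rw [add_mul, mul_add, mul_add, add_mul, mul_add, mul_add, sub_eq_zero.mp h0, hc hw s, hc hw z,
      hc hz t]
    abel
  have hcS : s * t - t * s ∈ S := sub_mem (mul_mem hs ht) (mul_mem ht hs)
  -- Write `v s = s' + v'` with `v'` central: then `v[s, t] = [v s, t] = [s', t]`. Hence `S` absorbs
  -- central multiples of `[s, t]`, and so contains all of `R[s, t]R`.
  have hzS : ∀ v ∈ Subring.center R, v * (s * t - t * s) ∈ S := fun v hv => by
    obtain ⟨s', hs', v', hv', e⟩ := hdec (v * s)
    have : v * (s * t - t * s) = s' * t - t * s' := by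
      have e' : s' = v * s - v' := by rw [e]; abel
      rw [e', mul_sub, sub_mul, mul_sub, hc hv' t, ← mul_assoc t, hc hv t]
      noncomm_ring
    rw [this]
    exact sub_mem (mul_mem hs' ht) (mul_mem ht hs')
  have := eq_top_of_forall_mul_mem S.toAddSubgroup hne fun r r' => by
    obtain ⟨p, hp, v, hv, rfl⟩ := hdec r
    obtain ⟨p', hp', v', hv', rfl⟩ := hdec r'
    have e : (p + v) * (s * t - t * s) * (p' + v') =
        p * (s * t - t * s) * p' + p * (v' * (s * t - t * s)) + v * (s * t - t * s) * p' +
        v' * v * (s * t - t * s) := by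
      rw [mul_add, hc hv' ((p + v) * (s * t - t * s)), ← mul_assoc p, hc hv' p]
      noncomm_ring
    rw [e]
    change _ ∈ S
    exact add_mem (add_mem (add_mem (mul_mem (mul_mem hp hcS) hp') (mul_mem hp (hzS v' hv')))
      (mul_mem (hzS v hv) hp')) (hzS _ (mul_mem hv' hv))
  rw [eq_top_iff]
  intro x _
  have hx : x ∈ S.toAddSubgroup := this ▸ AddSubgroup.mem_top x
  exact hx

/-- Over a field with more than three elements, if one nontrivial transvection centralizes all
transvections modulo `N`, then every transvection does. -/
theorem forall_tMat_mem_of_commutative [IsSimpleRing R]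
    (hcentre : 4 ≤ ENat.card (Subring.center R)) (hcomm : ∀ a b : R, a * b = b * a)
    {N : Subgroup (GLTwo R)} (hN : EL R ≤ Subgroup.normalizer (N : Set (GLTwo R)))
    {a : R} (ha : a ≠ 0) (haM : tMat a ∈ Subgroup.centralizerMod N (EL R)) (b : R) :
    tMat b ∈ Subgroup.centralizerMod N (EL R) := by
  have hunit : ∀ x : R, x ≠ 0 → IsUnit x := fun x hx =>
    isUnit_of_mem_center (Subring.mem_center_iff.mpr fun y => hcomm y x) hx
  have hsq : ∀ r : Rˣ, ∀ c ∈ level (Subgroup.centralizerMod N (EL R)),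
      r * c * r ∈ level (Subgroup.centralizerMod N (EL R)) := fun r c hc => by
    have := Subgroup.conj_mem_centralizerMod (mem_level.mp hc) (hN (mMat_inv_mem_EL r))
      (Subgroup.le_normalizer (mMat_inv_mem_EL r))
    rwa [mMat_conj_tMat, inv_inv] at this
  obtain ⟨a, rfl⟩ := hunit a ha
  rw [← mem_level] at haM ⊢
  by_cases h2 : (2 : R) = 0
  -- Characteristic 2, where halving is impossible. If `u` is in the level, so is `u⁻¹ = u⁻¹ u u⁻¹`,
  -- whence `wMat u ∈ M`. The quotient of two such elements is `diag(z², z⁻²)`, and its commutator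
  -- with `tMat c` has entry `(z⁴ - 1)c = (z - 1)⁴c`.
  · obtain ⟨z, hz, hz1, -⟩ := exists_center_unit hcentre
    have hw : ∀ u : Rˣ, (u : R) ∈ level (Subgroup.centralizerMod N (EL R)) →
        wMat u ∈ Subgroup.centralizerMod N (EL R) := fun u hu => by
      have hl := inv_mem (lMat_mem_of_tMat_mem hN (mem_level.mp (hsq u⁻¹ u hu)))
      rw [lMat_inv, Units.inv_mul, one_mul] at hl
      exact mul_mem (mul_mem hu hl) hu
    have hU : ∀ r s : Rˣ, r * s = s * r := fun r s => Units.ext (hcomm r s)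
    have hza : z * z * a = z * a * z := by rw [mul_assoc, mul_assoc, hU a z]
    have h₁ := mul_mem (hw (z * z * a) (by simpa [hza] using hsq z a haM)) (inv_mem (hw a haM))
    rw [wMat_mul_wMat_inv, mul_inv_cancel_right, mul_inv_rev, mul_assoc, hU (z * z)⁻¹ a,
      inv_mul_cancel_left] at h₁
    obtain ⟨p, hp⟩ := hunit ((z : R) - 1) (sub_ne_zero.mpr hz1)
    set c : R := ((p⁻¹ * p⁻¹ * p⁻¹ * p⁻¹ : Rˣ) : R) * b with hc
    have h₂ := h₁.2 _ (tMat_mem_EL c)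
    rw [mMat_conj_tMat, tMat_inv, tMat_mul, inv_inv] at h₂
    have hq : ((z * z : Rˣ) : R) * c * ((z * z : Rˣ) : R) + -c = b := by
      have h4 : (p : R) * p * p * p = z * z * z * z - 1 := by
        have e : ((z : R) - 1) * (z - 1) * (z - 1) * (z - 1) = z * z * z * z - 1 +
            2 * (1 - 2 * z + 3 * z * z - 2 * z * z * z) := by noncomm_ring
        rw [hp, e, h2, zero_mul, add_zero]
      have : b = (p : R) * p * p * p * c := by
        rw [hc, ← Units.val_mul, ← Units.val_mul, ← Units.val_mul, ← mul_assoc, ← Units.val_mul]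
        simp [mul_assoc]
      rw [this, h4, mul_assoc, hcomm c, sub_one_mul, sub_eq_add_neg]
      push_cast
      simp only [mul_assoc]
    rw [hq] at h₂
    exact Subgroup.le_centralizerMod hN h₂
  · obtain ⟨t, ht⟩ := hunit 2 h2
    have hmem : ∀ x : R, x * a * x ∈ level (Subgroup.centralizerMod N (EL R)) := fun x => by
      by_cases hx : x = 0
      · simp [hx, zero_mem]
      · obtain ⟨x, rfl⟩ := hunit x hx
        exact hsq x a haM
    set c : R := (a⁻¹ : Rˣ) * b with hc
    -- Polarization: `c = ((c + 1)/2)² - ((c - 1)/2)²`, multiplied by `a`.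
    have key : b = (t⁻¹ : Rˣ) * (c + 1) * a * ((t⁻¹ : Rˣ) * (c + 1)) -
        (t⁻¹ : Rˣ) * (c - 1) * a * ((t⁻¹ : Rˣ) * (c - 1)) := by
      have hac : a * c = b := by rw [hc, Units.mul_inv_cancel_left]
      have hx : ∀ x : R, (t⁻¹ : Rˣ) * x * a * ((t⁻¹ : Rˣ) * x) =
          (t⁻¹ : Rˣ) * ((t⁻¹ : Rˣ) * (x * a * x)) := fun x => by
        rw [← mul_assoc _ _ x, hcomm _ ((t⁻¹ : Rˣ) : R)]
        simp only [mul_assoc]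
      have e : (c + 1) * a * (c + 1) - (c - 1) * a * (c - 1) = 2 * (c * a + a * c) := by
        noncomm_ring
      rw [hx, hx, ← mul_sub, ← mul_sub, e, hcomm c, hac, ← two_mul b, ← ht,
        Units.inv_mul_cancel_left, Units.inv_mul_cancel_left]
    rw [key]
    exact sub_mem (hmem _) (hmem _)

/-- Under the generation hypothesis, a subgroup normalized by the transvections and having a
nonscalar element contains all transvections. -/
theorem EL_le_of_EL_le_normalizer [IsSimpleRing R]
    (hcentre : 4 ≤ ENat.card (Subring.center R))
    (hadd : AddSubgroup.closure (unitCommutators R ∪ centralUnits R) = ⊤)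
    (hR : StableRangeOne R ∨ TranslatesMeet R 3) {N : Subgroup (GLTwo R)}
    (hN : EL R ≤ Subgroup.normalizer (N : Set (GLTwo R))) {g : GLTwo R} (hg : g ∈ N)
    (hns : ¬ IsScalar g) : EL R ≤ N := by
  obtain ⟨a, ha, haM⟩ := exists_tMat_mem hcentre hR hN hg hns
  refine EL_le_of_forall_tMat_mem hcentre hN ?_
  by_cases hcomm : ∀ a b : R, a * b = b * a
  · exact forall_tMat_mem_of_commutative hcentre hcomm hN ha haM
  push Not at hcomm
  have hconj : ∀ k ∈ EL R, ∀ h ∈ Subgroup.centralizerMod N (EL R),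
      k * h * k⁻¹ ∈ Subgroup.centralizerMod N (EL R) := fun k hk h hh =>
    Subgroup.conj_mem_centralizerMod hh (hN hk) (Subgroup.le_normalizer hk)
  have htop := eq_top_of_forall_mul_mem (level (Subgroup.centralizerMod N (EL R))) ha
    (mul_mul_mem_of_closure_eq_top (closure_unitCommutators_eq_top hadd hcomm) _
      (by
        rintro _ ⟨u, hu, rfl⟩ b hb
        have := hconj _ (mMat_one_right_mem_EL hu) _ (mem_level.mp hb)
        rw [mMat_conj_tMat] at this
        simpa [mem_level] using this)
      (by
        rintro _ ⟨u, hu, rfl⟩ b hb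
        -- Right multiplication by `u` comes from conjugating the lower transvection by `diag(u⁻¹,
        -- 1)`.
        have := hconj _ (mMat_one_right_mem_EL (inv_mem hu)) _
          (lMat_mem_of_tMat_mem hN (mem_level.mp hb))
        rw [mMat_conj_lMat] at this
        simpa [mem_level] using tMat_mem_of_lMat_mem hN this) haM)
  exact fun b => mem_level.mp (htop ▸ AddSubgroup.mem_top b)

/-! ### Passage to the projective group -/

/-- The preimage in `GL(2,R)` of a subgroup of `PE(2,R)`. -/
def lift (N : Subgroup (PE R)) : Subgroup (GLTwo R) :=
  (N.comap (QuotientGroup.mk' (scalars R))).map (E R).subtype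

theorem mem_lift {N : Subgroup (PE R)} {g : GLTwo R} :
    g ∈ lift N ↔ ∃ h : g ∈ E R, (QuotientGroup.mk (s := scalars R) ⟨g, h⟩ : PE R) ∈ N := by
  constructor
  · rintro ⟨⟨g, h⟩, hg, rfl⟩
    exact ⟨h, hg⟩
  · rintro ⟨h, hg⟩
    exact ⟨⟨g, h⟩, hg, rfl⟩

theorem mem_normalizer_lift {N : Subgroup (PE R)} {g : GLTwo R} (hg : g ∈ E R)
    (h : (QuotientGroup.mk (s := scalars R) ⟨g, hg⟩ : PE R) ∈
      Subgroup.normalizer (N : Set (PE R))) :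
    g ∈ Subgroup.normalizer (lift N : Set (GLTwo R)) := by
  rw [Subgroup.mem_normalizer_iff]
  intro x
  rw [mem_lift, mem_lift]
  constructor
  · rintro ⟨hx, hxN⟩
    exact ⟨mul_mem (mul_mem hg hx) (inv_mem hg), (Subgroup.mem_normalizer_iff.mp h _).mp hxN⟩
  · rintro ⟨hx, hxN⟩
    have hx' : x ∈ E R := by
      have := mul_mem (mul_mem (inv_mem hg) hx) hg
      simpa [mul_assoc] using this
    exact ⟨hx', (Subgroup.mem_normalizer_iff.mp h _).mpr hxN⟩

theorem exists_not_isScalar {N : Subgroup (PE R)} (hN : N ≠ ⊥) :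
    ∃ g ∈ lift N, ¬ IsScalar g := by
  by_contra! hcon
  refine hN ((Subgroup.eq_bot_iff_forall _).mpr fun x hx => ?_)
  obtain ⟨⟨g, hg⟩, rfl⟩ := QuotientGroup.mk_surjective x
  exact (QuotientGroup.eq_one_iff _).mpr (hcon g (mem_lift.mpr ⟨hg, hx⟩))

/-- As `j² = 1`, `j t_a j` is lower unitriangular; thus `PE₂ R` is the image of `EL R`. -/
theorem e_mul_e (a b : R) : e a * e b =
    QuotientGroup.mk (s := scalars R) ⟨lMat a * tMat b,
      mul_mem (lMat_mem_E a) (tMat_mem_E b)⟩ := by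
  refine congrArg (QuotientGroup.mk (s := scalars R)) (Subtype.ext ?_)
  change jMat R * tMat a * (jMat R * tMat b) = lMat a * tMat b
  rw [← jMat_conj_tMat, jMat_inv, mul_assoc (jMat R * tMat a)]

theorem PE₂_le {N : Subgroup (PE R)} (h : EL R ≤ lift N) : PE₂ R ≤ N := by
  rw [PE₂, Subgroup.closure_le]
  rintro _ ⟨a, b, rfl⟩
  rw [e_mul_e]
  exact (mem_lift.mp (h (mul_mem (lMat_mem_EL a) (tMat_mem_EL b)))).2

theorem EL_le_lift_PE₂ : EL R ≤ lift (PE₂ R) := by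
  have key : ∀ a b : R, lMat a * tMat b ∈ lift (PE₂ R) := fun a b =>
    mem_lift.mpr ⟨mul_mem (lMat_mem_E a) (tMat_mem_E b),
      e_mul_e a b ▸ Subgroup.subset_closure ⟨a, b, rfl⟩⟩
  exact EL_le (fun b => by simpa using key 0 b) (fun a => by simpa using key a 0)

theorem nontrivial_PE₂ [Nontrivial R] : Nontrivial (PE₂ R) := by
  rw [Subgroup.nontrivial_iff_ne_bot]
  intro h
  obtain ⟨h₁, h₂⟩ := mem_lift.mp (EL_le_lift_PE₂ (tMat_mem_EL (1 : R)))
  rw [h, Subgroup.mem_bot, QuotientGroup.eq_one_iff] at h₂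
  obtain ⟨z, -, hz⟩ := h₂
  have := congrArg (fun g : GLTwo R => g.val 0 1) hz
  simp [tMat, mMat] at this

end ProjElem

theorem mainTheorem3 {R : Type*} [Ring R] [IsSimpleRing R]
    (hcentre : 4 ≤ ENat.card (Subring.center R))
    (hgen : Subring.closure {u : R | IsUnit u} = ⊤)
    (hR : ProjElem.StableRangeOne R ∨ ProjElem.TranslatesMeet R 3) :
    (∀ N : Subgroup (ProjElem.PE R), N.Normal → N ≠ ⊥ → ProjElem.PE₂ R ≤ N) ∧
    (AddSubgroup.closure (ProjElem.unitCommutators R ∪ ProjElem.centralUnits R) = ⊤ →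
      IsSimpleGroup (ProjElem.PE₂ R)) := by
  refine ⟨fun N hN hne => ?_, fun hadd => ?_⟩
  · obtain ⟨g, hg, hns⟩ := ProjElem.exists_not_isScalar hne
    refine ProjElem.PE₂_le (ProjElem.EL_le_of_E_le_normalizer hcentre hgen hR (fun k hk => ?_) hg
      hns)
    exact ProjElem.mem_normalizer_lift hk (Subgroup.normalizer_eq_top N ▸ Subgroup.mem_top _)
  · have := ProjElem.nontrivial_PE₂ (R := R)
    refine ⟨fun N hN => or_iff_not_imp_left.mpr fun hne => ?_⟩
    -- `N'` is normalized by `PE₂ R` but perhaps not by `PE R`, so its lift is only known to be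
    -- normalized by `EL R`.
    set N' := N.map (ProjElem.PE₂ R).subtype with hN'
    have hne' : N' ≠ ⊥ := fun h =>
      hne ((Subgroup.map_eq_bot_iff_of_injective _ (Subgroup.subtype_injective _)).mp h)
    obtain ⟨g, hg, hns⟩ := ProjElem.exists_not_isScalar hne'
    have hle := ProjElem.PE₂_le
      (ProjElem.EL_le_of_EL_le_normalizer hcentre hadd hR (N := ProjElem.lift N')
        (fun k hk => by
          obtain ⟨hkE, hk₂⟩ := ProjElem.mem_lift.mp (ProjElem.EL_le_lift_PE₂ hk)
          refine ProjElem.mem_normalizer_lift hkE ?_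
          have := Subgroup.le_normalizer_map (H := N) (ProjElem.PE₂ R).subtype
          refine this ⟨⟨_, hk₂⟩, ?_, rfl⟩
          exact Subgroup.normalizer_eq_top N ▸ Subgroup.mem_top _) hg hns)
    rw [eq_top_iff]
    intro x _
    obtain ⟨y, hy, hyx⟩ := hle x.2
    rwa [← Subtype.ext hyx]
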